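/- Let $\mathcal{L}(x)=\mathrm{Li}_2(x)+\tfrac12\log|x|\log(1-x)$ for $x\le 1$ (with $\mathcal L(0)=0$ and $\mathcal L(1)=\mathrm{Li}_2(1)$) be the Rogers function, where $\mathrm{Li}_2(x)=-\int_0^x\frac{\log(1-t)}{t}\,dt$, and let $$[z_1,z_2,z_3,z_4]=\frac{(z_1-z_2)(z_4-z_3)}{(z_1-z_3)(z_4-z_2)}.$$ (1) Let $n\ge 3$ and let $x_1,\dots,x_n$ be the vertices of an ideal $n$-gon, that is, distinct points of the unit circle (the boundary of the Poincaré disk) in anticlockwise cyclic order, with indices read modulo $n$. Let $s_i$ be the side $x_ix_{i+1}$. For all sides $s_i,s_j$ without a common ideal endpoint, the cross-ratio $[x_i,x_{i+1},x_j,x_{j+1}]$ is a real number in $(0,1)$, and $$\sum_{i<j,\ s_i\cap s_j=\emptyset\text{ (also at infinity)}}\mathcal{L}\big([x_i,x_{i+1},x_j,x_{j+1}]\big)=\frac{(n-3)\pi^2}{6},$$ where every unordered pair of such sides is counted once. (2) This is a finite identity in $n-3$ independent variables, for every $n\ge 3$. There are $n(n-3)/2$ such pairs of sides. For $0<u_1<\dots<u_{n-3}<1$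 let $R_{ij}(u)$ be the cross-ratio of the sides $s_i,s_j$ of the ideal $n$-gon in the upper half-plane with vertices $0,u_1,\dots,u_{n-3},1,\infty$, in this order. It is a quotient of two polynomials with integer coefficients in $u_1,\dots,u_{n-3}$. On the domain $0<u_1<\dots<u_{n-3}<1$ its denominator does not vanish, $0<R_{ij}(u)<1$, and $\sum_{i<j}\mathcal{L}(R_{ij}(u))=(n-3)\pi^2/6$, the sum being over the same pairs. For every ideal $n$-gon there is exactly one $u$ in this domain with $[x_i,x_{i+1},x_j,x_{j+1}]=R_{ij}(u)$ for all these pairs, and every such $u$ arises from an ideal $n$-gon in this way. (3) For $n=4$ the two cross-ratios are $b$ and $1-b$ with $b=u_1\in(0,1)$, and one recovers Euler's reflection identity: $\mathcal{L}(b)+\mathcal{L}(1-b)=\mathcal{L}(1)=\pi^2/6$ for $0\le b\le 1$; equivalently, $\mathcal{L}(a)+\mathcal{L}(a^{-1})=-\pi^2/6$ for $a<0$. (4) For $n=5$, with $u=u_1<v=u_2$ in $(0,1)$, the five cross-ratios are $$u,\quad 1-v,\quad \frac{v-u}{v},\quad \frac{v-u}{1-u},\quad \frac{u(1-v)}{v(1-u)},$$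 and one recovers Abel's five-term identity: for $0<x,y<1$, $$\mathcal{L}(x)+\mathcal{L}(y)=\mathcal{L}(xy)+\mathcal{L}\Big(\frac{x(1-y)}{1-xy}\Big)+\mathcal{L}\Big(\frac{y(1-x)}{1-xy}\Big).$$ -/

import Mathlib

noncomputable section

/-- The dilogarithm on the half-line `x ≤ 1`, i.e. `Li₂(x) = -∫₀ˣ log (1 - t) / t dt`. -/
def dilog (x : ℝ) : ℝ := -∫ t in (0 : ℝ)..x, Real.log (1 - t) / t

/-- The (extended) Rogers function `ℒ(x) = Li₂(x) + (1/2) log |x| log (1 - x)` for `x ≤ 1`.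
At `x = 0` and at `x = 1` the product of logarithms is `0`, which is its limit there. -/
def rogersL (x : ℝ) : ℝ := dilog x + 1 / 2 * Real.log |x| * Real.log (1 - x)

/-- The cross-ratio `[z₁, z₂, z₃, z₄] = (z₁ - z₂)(z₄ - z₃) / ((z₁ - z₃)(z₄ - z₂))`. -/
def crossRatio (z₁ z₂ z₃ z₄ : ℂ) : ℂ := ((z₁ - z₂) * (z₄ - z₃)) / ((z₁ - z₃) * (z₄ - z₂))

/-- `x` lists the vertices of an ideal polygon in the Poincaré disk: distinct points of the unit
circle, in anticlockwise cyclic order (arguments can be chosen strictly increasing and within one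
full turn). -/
def IsIdealPolygon {n : ℕ} (x : Fin n → Circle) : Prop :=
  ∃ θ : Fin n → ℝ, StrictMono θ ∧ (∀ i j, θ i < θ j + 2 * Real.pi) ∧ ∀ i, x i = Circle.exp (θ i)

/-- The (indices of the) two ideal endpoints of the `i`-th side `xᵢ xᵢ₊₁`, indices taken
cyclically. -/
def side (n : ℕ) (i : Fin n) : Finset (Fin n) := {i, finRotate n i}

/-- The pairs of sides of an ideal `n`-gon that have no ideal endpoint in common. Each unordered
pair is listed once, with the smaller index first. -/
def disjointSides (n : ℕ) : Finset (Fin n × Fin n) :=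
  Finset.univ.filter fun p => p.1 < p.2 ∧ Disjoint (side n p.1) (side n p.2)

/-- The cross-ratio `[xᵢ, xᵢ₊₁, xⱼ, xⱼ₊₁]` of the endpoints of the sides `i` and `j`. -/
def sideCrossRatio {n : ℕ} (x : Fin n → Circle) (i j : Fin n) : ℂ :=
  crossRatio (x i) (x (finRotate n i)) (x j) (x (finRotate n j))

/-- Homogeneous coordinates, over `ℤ[u₁, …, uₙ₋₃]`, of the vertices
`0, u₁, …, uₙ₋₃, 1, ∞` of the general normalized ideal `n`-gon in the upper half-plane:
`z` has coordinates `(z, 1)` and `∞` has coordinates `(1, 0)`. -/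
def normalizedVertex (n : ℕ) (k : Fin n) :
    MvPolynomial (Fin (n - 3)) ℤ × MvPolynomial (Fin (n - 3)) ℤ :=
  if (k : ℕ) = 0 then (0, 1)
  else if h : (k : ℕ) - 1 < n - 3 then (MvPolynomial.X ⟨(k : ℕ) - 1, h⟩, 1)
  else if (k : ℕ) = n - 2 then (1, 1)
  else (1, 0)

/-- The determinant of the vertices `k` and `l`; it is the difference of two finite vertices. -/
def vertexDet (n : ℕ) (k l : Fin n) : MvPolynomial (Fin (n - 3)) ℤ :=
  (normalizedVertex n k).1 * (normalizedVertex n l).2 -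
    (normalizedVertex n l).1 * (normalizedVertex n k).2

/-- Numerator of the cross-ratio of the sides `i`, `j` of the normalized ideal `n`-gon. -/
def sideNum (n : ℕ) (i j : Fin n) : MvPolynomial (Fin (n - 3)) ℤ :=
  vertexDet n i (finRotate n i) * vertexDet n (finRotate n j) j

/-- Denominator of the cross-ratio of the sides `i`, `j` of the normalized ideal `n`-gon. -/
def sideDen (n : ℕ) (i j : Fin n) : MvPolynomial (Fin (n - 3)) ℤ :=
  vertexDet n i j * vertexDet n (finRotate n j) (finRotate n i)

/-- The value at `u` of the rational function `sideNum / sideDen` of `n - 3` variables. -/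
def sideRatio (n : ℕ) (i j : Fin n) (u : Fin (n - 3) → ℝ) : ℝ :=
  MvPolynomial.aeval u (sideNum n i j) / MvPolynomial.aeval u (sideDen n i j)

/-- The domain `0 < u₁ < ⋯ < uₙ₋₃ < 1` of the variables. -/
def polygonParameters (n : ℕ) : Set (Fin (n - 3) → ℝ) :=
  {u | StrictMono u ∧ ∀ k, 0 < u k ∧ u k < 1}

end

/-!
The Rogers function has derivative `-(log (1 - x) / x + log x / (1 - x)) / 2`, so the derivative of
a functional equation between values at products of `x`, `1 - x`, … is linear in logarithms and
vanishes by inspection. Since `rogersL` is continuous on `[0, 1]`, this gives Euler's reflection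
identity (`rogersL_add_rogersL_one_sub`, with constant `rogersL 1 = ζ(2)`), Abel's five-term
identity (`rogersL_five_term`), and Landen's identity (`rogersL_of_neg`), which carries Euler's
identity over to the negative half-line.

Points of the real projective line are represented by vectors of the plane, and all cross-ratios
are expressed by the determinants `det₂`; for vectors in cyclic order these determinants are
positive, and the Plücker relation gives `1 - [a, b, c, d] = [b, c, d, a]`. In these terms the
five-term identity says (`rogersL_insert_vertex`): if a new vertex `y` is inserted in the side
`c d` of a polygon, then the change of the contribution of another side `a b` is `A a - A b`, where
`A k = ℒ [k, c, y, d]`. The sum of these changes telescopes, the two remaining terms add up to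
`π² / 6` by Euler's identity, and the theorem for vectors follows by induction on the number of
vertices (`sum_rogersL_vecRatio`).

The point `exp (i θ)` of the circle corresponds to the vector `(-cos (θ / 2), sin (θ / 2))`, and the
cross-ratios agree, so the identity holds in the disk. A linear map that takes the first, the
penultimate and the last vertex to `0`, `1`, `∞` normalizes any polygon
(`exists_normalizedVec`); the parameters are unique because the cross-ratios with the closing side
determine the quotients of consecutive vertices (`polygonParameters_ext`).
-/

open Real Set Filter Topology MeasureTheory

/-! ### The dilogarithm and the Rogers function -/

/-- The continuous extension across `t = 0` of `log (1 - t) / t`. -/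
noncomputable def dilogKernel (t : ℝ) : ℝ := dslope (fun s : ℝ => Real.log (1 - s)) 0 t

theorem dilogKernel_of_ne {t : ℝ} (ht : t ≠ 0) : dilogKernel t = Real.log (1 - t) / t := by
  simp [dilogKernel, dslope_of_ne _ ht, slope_def_field]

theorem mul_dilogKernel (t : ℝ) : t * dilogKernel t = Real.log (1 - t) := by
  rcases eq_or_ne t 0 with rfl | ht
  · simp
  · rw [dilogKernel_of_ne ht]; field_simp

theorem continuousAt_dilogKernel {t : ℝ} (ht : t < 1) : ContinuousAt dilogKernel t := by
  have hd : ∀ s : ℝ, s < 1 → DifferentiableAt ℝ (fun s : ℝ => Real.log (1 - s)) s := fun s hs =>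
    ((differentiableAt_const _).sub differentiableAt_id).log (by simp; linarith)
  rcases eq_or_ne t 0 with rfl | h
  · exact continuousAt_dslope_same.2 (hd 0 ht)
  · exact (continuousAt_dslope_of_ne h).2 (hd t ht).continuousAt

theorem dilog_eq_integral_dilogKernel (x : ℝ) : dilog x = -∫ t in (0 : ℝ)..x, dilogKernel t := by
  rw [dilog]
  congr 1
  apply intervalIntegral.integral_congr_ae
  have : ∀ᵐ t : ℝ, t ≠ 0 := by simp [ae_iff]
  filter_upwards [this] with t ht _
  rw [dilogKernel_of_ne ht]

theorem intervalIntegrable_dilogKernel {a b : ℝ} (ha : a ≤ 1) (hb : b ≤ 1) :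
    IntervalIntegrable dilogKernel volume a b := by
  have low : ∀ c : ℝ, c < 1 → IntervalIntegrable dilogKernel volume (1 / 2) c := fun c hc =>
    ContinuousOn.intervalIntegrable fun t ht => (continuousAt_dilogKernel (by
      have := ht.2
      have : max (1 / 2) c < 1 := max_lt (by norm_num) hc
      linarith)).continuousWithinAt
  have high : IntervalIntegrable dilogKernel volume (1 / 2) 1 := by
    have h1 : IntervalIntegrable (fun t : ℝ => Real.log (1 - t)) volume (1 / 2) 1 := by
      have := (intervalIntegral.intervalIntegrable_log' (a := 1 / 2) (b := 0)).comp_sub_left 1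
      norm_num at this ⊢
      exact this
    have h2 : ContinuousOn (fun t : ℝ => t⁻¹) (uIcc (1 / 2) 1) := by
      refine continuousOn_inv₀.mono fun t ht => ?_
      rw [uIcc_of_le (by norm_num)] at ht
      have := ht.1
      simp only [mem_compl_iff, mem_singleton_iff]
      linarith
    refine (h1.mul_continuousOn h2).congr fun t ht => ?_
    rw [uIoc_of_le (by norm_num)] at ht
    have : t ≠ 0 := by have := ht.1; linarith
    simp only [dilogKernel_of_ne this, div_eq_mul_inv]
  have all : ∀ c : ℝ, c ≤ 1 → IntervalIntegrable dilogKernel volume (1 / 2) c := by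
    intro c hc
    rcases hc.lt_or_eq with h | rfl
    · exact low c h
    · exact high
  exact (all a ha).symm.trans (all b hb)

theorem hasDerivAt_dilog {x : ℝ} (hx : x < 1) : HasDerivAt dilog (-dilogKernel x) x := by
  have e : dilog = fun x => -∫ t in (0 : ℝ)..x, dilogKernel t :=
    funext dilog_eq_integral_dilogKernel
  rw [e]
  refine (intervalIntegral.integral_hasDerivAt_right
    (intervalIntegrable_dilogKernel zero_le_one hx.le) ?_ (continuousAt_dilogKernel hx)).neg
  exact ContinuousOn.stronglyMeasurableAtFilter isOpen_Iio
    (fun t ht => (continuousAt_dilogKernel ht).continuousWithinAt) x hx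

theorem continuousOn_dilog : ContinuousOn dilog (Icc 0 1) := by
  have e : dilog = fun x => -∫ t in (0 : ℝ)..x, dilogKernel t :=
    funext dilog_eq_integral_dilogKernel
  rw [e]
  have := intervalIntegral.continuousOn_primitive_interval (f := dilogKernel) (μ := volume)
    (a := 0) (b := 1) (by
      rw [uIcc_of_le zero_le_one, integrableOn_Icc_iff_integrableOn_Ioc,
        ← intervalIntegrable_iff_integrableOn_Ioc_of_le zero_le_one]
      exact intervalIntegrable_dilogKernel zero_le_one le_rfl)
  rw [uIcc_of_le zero_le_one] at this
  exact this.neg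

/-- The product of logarithms in the Rogers function has removable singularities at `0` and `1`;
the convention `log 0 = 0` fills in the correct values. -/
theorem continuous_log_mul_log_one_sub :
    Continuous fun x : ℝ => Real.log x * Real.log (1 - x) := by
  have low : ∀ x : ℝ, x < 1 → ContinuousAt (fun x : ℝ => Real.log x * Real.log (1 - x)) x := by
    intro x hx
    have e : (fun x : ℝ => Real.log x * Real.log (1 - x))
        = fun x => (x * Real.log x) * dilogKernel x := by
      funext t; rw [← mul_dilogKernel]; ring
    rw [e]
    exact Real.continuous_mul_log.continuousAt.mul (continuousAt_dilogKernel hx)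
  refine continuous_iff_continuousAt.2 fun x => ?_
  rcases lt_or_ge x 1 with hx | hx
  · exact low x hx
  -- the function is symmetric under `x ↦ 1 - x`
  · have h := low (1 - x) (by linarith)
    have h2 : ContinuousAt (fun x : ℝ => 1 - x) x := by fun_prop
    have := ContinuousAt.comp (f := fun x : ℝ => 1 - x) h h2
    refine this.congr (Eventually.of_forall fun t => ?_)
    simp [mul_comm]

theorem rogersL_eq (x : ℝ) : rogersL x = dilog x + 1 / 2 * (Real.log x * Real.log (1 - x)) := by
  rw [rogersL, Real.log_abs]; ring

theorem rogersL_zero : rogersL 0 = 0 := by simp [rogersL, dilog]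

theorem continuousAt_rogersL {x : ℝ} (hx : x < 1) : ContinuousAt rogersL x := by
  rw [funext rogersL_eq]
  exact (hasDerivAt_dilog hx).continuousAt.add
    (continuous_log_mul_log_one_sub.continuousAt.const_mul _)

theorem continuousOn_rogersL : ContinuousOn rogersL (Icc 0 1) := by
  rw [funext rogersL_eq]
  exact continuousOn_dilog.add (continuous_log_mul_log_one_sub.continuousOn.const_mul _)

theorem hasDerivAt_rogersL {x : ℝ} (h0 : x ≠ 0) (hx : x < 1) :
    HasDerivAt rogersL (-(1 / 2) * (Real.log (1 - x) / x + Real.log x / (1 - x))) x := by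
  rw [funext rogersL_eq]
  have h1 : (1 - x) ≠ 0 := by linarith
  have hl : HasDerivAt (fun x : ℝ => Real.log (1 - x)) (-1 / (1 - x)) x :=
    ((hasDerivAt_id x).const_sub 1).log h1
  have := (hasDerivAt_dilog hx).add (((Real.hasDerivAt_log h0).mul hl).const_mul (1 / 2))
  refine this.congr_deriv ?_
  rw [dilogKernel_of_ne h0]
  field_simp
  ring

/-- The chain rule for the Rogers function, with the derivatives of `log |f|` and of
`log (1 - f)` as data. In this form the derivative of a functional equation becomes linear in
logarithms. -/
theorem HasDerivAt.rogersL {f : ℝ → ℝ} {f' p q x : ℝ} (hf : HasDerivAt f f' x) (h0 : f x ≠ 0)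
    (h1 : f x < 1) (hp : f' = p * f x) (hq : f' = -q * (1 - f x)) :
    HasDerivAt (fun t => rogersL (f t))
      (-(1 / 2) * (Real.log (1 - f x) * p - Real.log (f x) * q)) x := by
  refine ((hasDerivAt_rogersL h0 h1).comp x hf).congr_deriv ?_
  have h2 : (1 - f x) ≠ 0 := by linarith
  have ep : f' / f x = p := by rw [hp]; field_simp
  have eq : f' / (1 - f x) = -q := by rw [hq]; field_simp
  calc _ = -(1 / 2) * (Real.log (1 - f x) * (f' / f x) + Real.log (f x) * (f' / (1 - f x))) := by
        field_simp
    _ = _ := by rw [ep, eq]; ring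

theorem dilog_one : dilog 1 = π ^ 2 / 6 := by
  have hint : ∀ n : ℕ, ∫ t in Ioc (0 : ℝ) 1, t ^ n / (n + 1) = 1 / ((n : ℝ) + 1) ^ 2 := by
    intro n
    rw [← intervalIntegral.integral_of_le zero_le_one, intervalIntegral.integral_div, integral_pow]
    simp
    field_simp
  have hsum : HasSum (fun n : ℕ => 1 / ((n : ℝ) + 1) ^ 2) (π ^ 2 / 6) := by
    have := (hasSum_nat_add_iff' 1).2 hasSum_zeta_two
    simpa using this
  have key := hasSum_integral_of_summable_integral_norm (μ := volume.restrict (Ioc (0 : ℝ) 1))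
    (F := fun (n : ℕ) (t : ℝ) => t ^ n / (n + 1))
    (fun n => ((continuous_id.pow n).div_const _).integrableOn_Ioc) (by
      refine hsum.summable.congr fun n => ?_
      rw [← hint n]
      refine setIntegral_congr_fun measurableSet_Ioc fun t ht => ?_
      have : 0 ≤ t ^ n / ((n : ℝ) + 1) := by have := ht.1.le; positivity
      exact (Real.norm_of_nonneg this).symm)
  simp only [hint] at key
  rw [hsum.unique key, dilog, intervalIntegral.integral_of_le zero_le_one, ← integral_neg]
  refine setIntegral_congr_ae measurableSet_Ioc ?_
  have : ∀ᵐ t : ℝ, t ≠ 1 := by simp [ae_iff]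
  filter_upwards [this] with t h1 ht
  have hlt : t < 1 := lt_of_le_of_ne ht.2 h1
  have ht0 : t ≠ 0 := ht.1.ne'
  have := (Real.hasSum_pow_div_log_of_abs_lt_one (x := t)
    (abs_lt.2 ⟨by linarith [ht.1], hlt⟩)).div_const t
  rw [← neg_div]
  rw [← this.tsum_eq]
  refine tsum_congr fun n => ?_
  field_simp
  ring

theorem rogersL_one : rogersL 1 = π ^ 2 / 6 := by
  simp [rogersL_eq, dilog_one]

/-! ### Functional equations -/

theorem eq_of_hasDerivAt_zero {f : ℝ → ℝ} {a b : ℝ} (hab : a ≤ b) (hc : ContinuousOn f (Icc a b))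
    (hd : ∀ x ∈ Ioo a b, HasDerivAt f 0 x) : f a = f b := by
  rcases hab.eq_or_lt with rfl | h
  · rfl
  · obtain ⟨c, -, hs⟩ := exists_hasDerivAt_eq_slope f (fun _ => 0) h hc hd
    have : b - a ≠ 0 := by linarith
    field_simp at hs
    linarith

/-- Euler's reflection identity. -/
theorem rogersL_add_rogersL_one_sub {b : ℝ} (h0 : 0 ≤ b) (h1 : b ≤ 1) :
    rogersL b + rogersL (1 - b) = π ^ 2 / 6 := by
  have hc : ContinuousOn (fun t => rogersL t + rogersL (1 - t)) (Icc 0 b) := by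
    refine (continuousOn_rogersL.mono (Icc_subset_Icc_right h1)).add
      (continuousOn_rogersL.comp (by fun_prop) fun t ht => ?_)
    exact ⟨by linarith [ht.2], by linarith [ht.1]⟩
  have hd : ∀ t ∈ Ioo (0 : ℝ) b, HasDerivAt (fun t => rogersL t + rogersL (1 - t)) 0 t := by
    intro t ht
    obtain ⟨ht0, htb⟩ := ht
    have e1 : (1 - t) ≠ 0 := by linarith
    have a := HasDerivAt.rogersL (p := 1 / t) (q := -1 / (1 - t)) (hasDerivAt_id t) ht0.ne'
      (show t < 1 by linarith) (by simp; field_simp) (by simp; field_simp)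
    have b := HasDerivAt.rogersL (p := -1 / (1 - t)) (q := 1 / t)
      ((hasDerivAt_id t).const_sub 1) e1 (by simp; linarith) (by simp; field_simp)
      (by simp; field_simp)
    refine (a.add b).congr_deriv ?_
    simp
    ring
  have := eq_of_hasDerivAt_zero h0 hc hd
  simp only [sub_zero, rogersL_zero, rogersL_one, zero_add] at this
  exact this.symm

/-- Abel's five-term identity. -/
theorem rogersL_five_term {x y : ℝ} (hx0 : 0 < x) (hx1 : x < 1) (hy0 : 0 < y) (hy1 : y < 1) :
    rogersL x + rogersL y = rogersL (x * y) + rogersL (x * (1 - y) / (1 - x * y)) +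
      rogersL (y * (1 - x) / (1 - x * y)) := by
  set F : ℝ → ℝ := fun t => rogersL t + rogersL y - rogersL (t * y)
    - rogersL (t * (1 - y) / (1 - t * y)) - rogersL (y * (1 - t) / (1 - t * y)) with hF
  have bnd : ∀ t : ℝ, 0 ≤ t → t < 1 → 0 < 1 - t * y := fun t h0 h1 => by nlinarith
  have hA : ∀ t : ℝ, 0 ≤ t → t < 1 → 1 - t * (1 - y) / (1 - t * y) = (1 - t) / (1 - t * y) :=
    fun t h0 h1 => by
      have h := (bnd t h0 h1).ne'
      have h' : 1 - y * t ≠ 0 := by rwa [mul_comm]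
      field_simp
      ring
  have hB : ∀ t : ℝ, 0 ≤ t → t < 1 → 1 - y * (1 - t) / (1 - t * y) = (1 - y) / (1 - t * y) :=
    fun t h0 h1 => by
      have h := (bnd t h0 h1).ne'
      have h' : 1 - y * t ≠ 0 := by rwa [mul_comm]
      field_simp
      ring
  have hA1 : ∀ t : ℝ, 0 ≤ t → t < 1 → t * (1 - y) / (1 - t * y) < 1 := fun t h0 h1 => by
    have := div_pos (sub_pos.2 h1) (bnd t h0 h1)
    linarith [hA t h0 h1]
  have hB1 : ∀ t : ℝ, 0 ≤ t → t < 1 → y * (1 - t) / (1 - t * y) < 1 := fun t h0 h1 => by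
    have := div_pos (sub_pos.2 hy1) (bnd t h0 h1)
    linarith [hB t h0 h1]
  have hc : ContinuousOn F (Icc 0 x) := by
    intro t ht
    have ht1 : t < 1 := by linarith [ht.2]
    have hn := (bnd t ht.1 ht1).ne'
    refine ContinuousAt.continuousWithinAt ?_
    refine ((((continuousAt_rogersL ht1).add continuousAt_const).sub ?_).sub ?_).sub ?_
    · exact ContinuousAt.comp (f := fun t => t * y)
        (continuousAt_rogersL (by linarith [bnd t ht.1 ht1])) (by fun_prop)
    · exact ContinuousAt.comp (f := fun t => t * (1 - y) / (1 - t * y))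
        (continuousAt_rogersL (hA1 t ht.1 ht1)) (by fun_prop (disch := assumption))
    · exact ContinuousAt.comp (f := fun t => y * (1 - t) / (1 - t * y))
        (continuousAt_rogersL (hB1 t ht.1 ht1)) (by fun_prop (disch := assumption))
  have hd : ∀ t ∈ Ioo 0 x, HasDerivAt F 0 t := by
    intro t ht
    obtain ⟨ht0, htx⟩ := ht
    have ht1 : t < 1 := by linarith
    have hD := bnd t ht0.le ht1
    have n0 := ht0.ne'
    have n1 : 1 - t ≠ 0 := by linarith
    have ny : y ≠ 0 := hy0.ne'
    have ny1 : 1 - y ≠ 0 := by linarith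
    have nD := hD.ne'
    have nD' : 1 - y * t ≠ 0 := by rwa [mul_comm]
    have dD : HasDerivAt (fun t => 1 - t * y) (-y) t :=
      (((hasDerivAt_id t).mul_const y).const_sub 1).congr_deriv (by simp)
    have d1 := HasDerivAt.rogersL (p := 1 / t) (q := -(1 / (1 - t))) (hasDerivAt_id t) n0
      ht1 (by simp; field_simp) (by simp; field_simp)
    have d2 := HasDerivAt.rogersL (p := 1 / t) (q := -(y / (1 - t * y)))
      ((hasDerivAt_id t).mul_const y) (mul_ne_zero n0 ny) (show t * y < 1 by linarith)
      (by simp; field_simp) (by simp; field_simp)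
    have d3 := HasDerivAt.rogersL (p := 1 / t + y / (1 - t * y))
      (q := -(1 / (1 - t)) + y / (1 - t * y))
      (((hasDerivAt_id t).mul_const (1 - y)).div dD nD) (by simp; tauto) (hA1 t ht0.le ht1)
      (by simp; field_simp) (by simp [hA t ht0.le ht1]; field_simp; ring)
    have d4 := HasDerivAt.rogersL (p := -(1 / (1 - t)) + y / (1 - t * y))
      (q := y / (1 - t * y))
      ((((hasDerivAt_id t).const_sub 1).const_mul y).div dD nD) (by simp; tauto)
      (hB1 t ht0.le ht1)
      (by simp; field_simp) (by simp [hB t ht0.le ht1]; field_simp; ring)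
    refine ((((d1.add_const (rogersL y)).sub d2).sub d3).sub d4).congr_deriv ?_
    simp only [id, Pi.div_apply, hA t ht0.le ht1, hB t ht0.le ht1]
    rw [Real.log_div n1 nD, Real.log_div ny1 nD, Real.log_div (mul_ne_zero n0 ny1) nD,
      Real.log_div (mul_ne_zero ny n1) nD, Real.log_mul n0 ny1, Real.log_mul ny n1,
      Real.log_mul n0 ny]
    ring
  have := eq_of_hasDerivAt_zero hx0.le hc hd
  simp only [hF, zero_mul, sub_zero, mul_one, div_one, rogersL_zero] at this
  linarith

/-- Landen's identity: the Rogers function on the negative half-line in terms of its values on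
`(0, 1)`. -/
theorem rogersL_of_neg {a : ℝ} (ha : a < 0) : rogersL a = -rogersL (a / (a - 1)) := by
  have hw : ∀ t : ℝ, t ≤ 0 → 1 - t / (t - 1) = (1 - t)⁻¹ := fun t ht => by
    have : t - 1 ≠ 0 := by linarith
    have : 1 - t ≠ 0 := by linarith
    field_simp
    ring
  have hw1 : ∀ t : ℝ, t ≤ 0 → t / (t - 1) < 1 := fun t ht => by
    have : 0 < (1 - t)⁻¹ := inv_pos.2 (by linarith)
    linarith [hw t ht]
  have hc : ContinuousOn (fun t => rogersL t + rogersL (t / (t - 1))) (Icc a 0) := by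
    intro t ht
    have n1 : t - 1 ≠ 0 := by linarith [ht.2]
    refine ContinuousAt.continuousWithinAt ((continuousAt_rogersL (by linarith [ht.2])).add ?_)
    exact ContinuousAt.comp (f := fun t => t / (t - 1))
        (continuousAt_rogersL (hw1 t ht.2)) (by fun_prop (disch := assumption))
  have hd : ∀ t ∈ Ioo a 0, HasDerivAt (fun t => rogersL t + rogersL (t / (t - 1))) 0 t := by
    intro t ht
    have ht0 : t < 0 := ht.2
    have n0 := ht0.ne
    have n1 : 1 - t ≠ 0 := by linarith
    have n2 : t - 1 ≠ 0 := by linarith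
    have d1 := HasDerivAt.rogersL (p := 1 / t) (q := -(1 / (1 - t))) (hasDerivAt_id t) n0
      (show t < 1 by linarith) (by simp; field_simp) (by simp; field_simp)
    have d2 := HasDerivAt.rogersL (p := 1 / t + 1 / (1 - t)) (q := 1 / (1 - t))
      ((hasDerivAt_id t).div ((hasDerivAt_id t).sub_const 1) n2) (div_ne_zero n0 n2) (hw1 t ht0.le)
      (by simp; field_simp; ring) (by simp [hw t ht0.le]; field_simp; ring)
    refine (d1.add d2).congr_deriv ?_
    simp only [id, Pi.div_apply, hw t ht0.le, Real.log_inv]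
    rw [Real.log_div n0 n2, ← Real.log_neg_eq_log (t - 1), neg_sub]
    ring
  have := eq_of_hasDerivAt_zero ha.le hc hd
  simp only [zero_div, rogersL_zero, add_zero] at this
  linarith

theorem rogersL_add_rogersL_inv {a : ℝ} (ha : a < 0) :
    rogersL a + rogersL a⁻¹ = -(π ^ 2 / 6) := by
  have n1 : a - 1 ≠ 0 := by linarith
  have n2 : a⁻¹ - 1 ≠ 0 := by have := inv_lt_zero.2 ha; linarith
  have n3 : 1 - a ≠ 0 := by linarith
  have h0 : 0 ≤ a / (a - 1) := div_nonneg_of_nonpos ha.le (by linarith)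
  have h1 : a / (a - 1) ≤ 1 := by
    rw [div_le_one_of_neg (by linarith)]; linarith
  have e : a⁻¹ / (a⁻¹ - 1) = 1 - a / (a - 1) := by
    have := ha.ne
    field_simp
    ring
  rw [rogersL_of_neg ha, rogersL_of_neg (inv_lt_zero.2 ha), e,
    ← rogersL_add_rogersL_one_sub h0 h1]
  ring

/-! ### Cross-ratios of vectors in the plane -/

/-- The determinant of two vectors of the plane, signed so that it equals `z' - z` on the
homogeneous coordinates `(z, 1)`, `(z', 1)`. -/
def det₂ (p q : ℝ × ℝ) : ℝ := q.1 * p.2 - p.1 * q.2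

/-- The cross-ratio of four points of the real projective line in homogeneous coordinates. -/
noncomputable def vecRatio (a b c d : ℝ × ℝ) : ℝ :=
  (det₂ a b * det₂ d c) / (det₂ a c * det₂ d b)

theorem det₂_swap (a b : ℝ × ℝ) : det₂ b a = -det₂ a b := by simp [det₂]

theorem det₂_pluecker (a b c d : ℝ × ℝ) :
    det₂ a b * det₂ c d - det₂ a c * det₂ b d + det₂ a d * det₂ b c = 0 := by
  simp only [det₂]; ring

/-- Vectors in positive position: they represent points of the projective line in cyclic order. -/
def PositivePosition {ι : Type*} [LT ι] (p : ι → ℝ × ℝ) : Prop :=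
  ∀ i j, i < j → 0 < det₂ (p i) (p j)

section Quadruple

variable {a b c d : ℝ × ℝ}

theorem vecRatio_pos (hab : 0 < det₂ a b) (hac : 0 < det₂ a c) (hbd : 0 < det₂ d b)
    (hcd : 0 < det₂ d c) : 0 < vecRatio a b c d := by
  rw [vecRatio]
  positivity

theorem one_sub_vecRatio (hac : det₂ a c ≠ 0) (hbd : det₂ b d ≠ 0) :
    1 - vecRatio a b c d = vecRatio b c d a := by
  have h := det₂_pluecker a b c d
  rw [vecRatio, vecRatio, det₂_swap b d, det₂_swap c d]
  field_simp
  linear_combination -h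

end Quadruple

/-- The five-term identity for five points `d, a, b, c, y` in cyclic order: inserting `y` between
`c` and `d` changes the contribution of the side `ab` by a coboundary. -/
theorem rogersL_insert_vertex {a b c y d : ℝ × ℝ} (da : 0 < det₂ d a) (db : 0 < det₂ d b)
    (dc : 0 < det₂ d c) (dy : 0 < det₂ d y) (ab : 0 < det₂ a b) (ac : 0 < det₂ a c)
    (ay : 0 < det₂ a y) (bc : 0 < det₂ b c) (hby : 0 < det₂ b y) (cy : 0 < det₂ c y) :
    rogersL (vecRatio a b c y) + rogersL (vecRatio a b y d) - rogersL (vecRatio a b c d) =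
      rogersL (vecRatio a c y d) - rogersL (vecRatio b c y d) := by
  have ad : det₂ a d ≠ 0 := by rw [det₂_swap d a]; linarith
  have bd : det₂ b d ≠ 0 := by rw [det₂_swap d b]; linarith
  have cd : det₂ c d ≠ 0 := by rw [det₂_swap d c]; linarith
  have X0 : 0 < vecRatio a c y d := vecRatio_pos ac ay dc dy
  have Y0 : 0 < vecRatio a b c d := vecRatio_pos ab ac db dc
  have eX := one_sub_vecRatio ay.ne' cd
  have eY := one_sub_vecRatio ac.ne' bd
  have eZ := one_sub_vecRatio (b := b) ay.ne' bd
  have X1 : 0 < vecRatio c y d a := by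
    rw [vecRatio, det₂_swap d a, det₂_swap d c, mul_neg, neg_mul, neg_div_neg_eq]
    positivity
  have Y1 : 0 < vecRatio b c d a := by
    rw [vecRatio, det₂_swap d a, det₂_swap d b, mul_neg, neg_mul, neg_div_neg_eq]
    positivity
  have exy : vecRatio a c y d * vecRatio a b c d = vecRatio a b y d := by
    simp only [vecRatio]
    field_simp
  -- with `d = 0` and `y = ∞` the two variables are `(c - a) / c` and `(b - a) c / ((c - a) b)`
  have h := rogersL_five_term X0 (by linarith) Y0 (by linarith)
  rw [exy, eX, eY, eZ] at h
  have e1 : vecRatio a c y d * vecRatio b c d a / vecRatio b y d a = vecRatio b c y d := by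
    simp only [vecRatio]
    field_simp
  have e2 : vecRatio a b c d * vecRatio c y d a / vecRatio b y d a = vecRatio a b c y := by
    simp only [vecRatio]
    rw [det₂_swap d c, det₂_swap d b, det₂_swap c y, det₂_swap b y]
    field_simp
  rw [e1, e2] at h
  linarith

/-- The identity for the polygon with vertices `q 0, …, q (k + 2)`. The first sum is over the pairs
of sides `q i q (i + 1)`, the second one over the pairs that contain the closing side. The
induction inserts a new vertex into the closing side. -/
theorem sum_rogersL_vecRatio (q : ℕ → ℝ × ℝ) (k : ℕ)
    (hq : ∀ i j, i < j → j ≤ k + 2 → 0 < det₂ (q i) (q j)) :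
    ∑ j ∈ Finset.range (k + 2), ∑ i ∈ Finset.range (j - 1),
        rogersL (vecRatio (q i) (q (i + 1)) (q j) (q (j + 1))) +
      ∑ i ∈ Finset.range k, rogersL (vecRatio (q (i + 1)) (q (i + 2)) (q (k + 2)) (q 0)) =
    k * (π ^ 2 / 6) := by
  induction k with
  | zero => simp [Finset.sum_range_succ]
  | succ k ih =>
    have ih := ih fun i j hij hj => hq i j hij (by omega)
    -- each old side contributes a difference, so the sum over the old sides telescopes
    have tel : ∀ i ∈ Finset.range k,
        rogersL (vecRatio (q (i + 1)) (q (i + 2)) (q (k + 2)) (q (k + 3))) +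
          rogersL (vecRatio (q (i + 1)) (q (i + 2)) (q (k + 3)) (q 0)) -
          rogersL (vecRatio (q (i + 1)) (q (i + 2)) (q (k + 2)) (q 0)) =
        rogersL (vecRatio (q (i + 1)) (q (k + 2)) (q (k + 3)) (q 0)) -
          rogersL (vecRatio (q (i + 1 + 1)) (q (k + 2)) (q (k + 3)) (q 0)) := by
      intro i hi
      have hi := Finset.mem_range.1 hi
      apply rogersL_insert_vertex <;> exact hq _ _ (by omega) (by omega)
    have tel := Finset.sum_congr rfl tel
    rw [Finset.sum_range_sub'
        (fun i => rogersL (vecRatio (q (i + 1)) (q (k + 2)) (q (k + 3)) (q 0))),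
      Finset.sum_sub_distrib, Finset.sum_add_distrib] at tel
    -- the remaining two terms are exchanged by `x ↦ 1 - x`
    have h1 : 0 < vecRatio (q 0) (q 1) (q (k + 2)) (q (k + 3)) := by
      rw [vecRatio, det₂_swap (q (k + 2)) (q (k + 3)), det₂_swap (q 1) (q (k + 3)), mul_neg,
        mul_neg, neg_div_neg_eq]
      have a1 := hq 0 1 (by omega) (by omega)
      have a2 := hq (k + 2) (k + 3) (by omega) (by omega)
      have a3 := hq 0 (k + 2) (by omega) (by omega)
      have a4 := hq 1 (k + 3) (by omega) (by omega)
      positivity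
    have h2 : 0 < vecRatio (q 1) (q (k + 2)) (q (k + 3)) (q 0) :=
      vecRatio_pos (hq _ _ (by omega) (by omega)) (hq _ _ (by omega) (by omega))
        (hq _ _ (by omega) (by omega)) (hq _ _ (by omega) (by omega))
    have h3 := one_sub_vecRatio (hq 0 (k + 2) (by omega) (by omega)).ne'
      (hq 1 (k + 3) (by omega) (by omega)).ne'
    have euler := rogersL_add_rogersL_one_sub h1.le (by linarith)
    rw [h3] at euler
    rw [Finset.sum_range_succ, Finset.sum_range_succ _ k, show k + 2 - 1 = k + 1 by omega,
      Finset.sum_range_succ' _ k]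
    push_cast
    simp only [zero_add, add_assoc, Nat.reduceAdd] at tel ih euler ⊢
    linarith

/-! ### Pairs of disjoint sides of a polygon -/

theorem mem_disjointSides {m : ℕ} {p : Fin (m + 1) × Fin (m + 1)} :
    p ∈ disjointSides (m + 1) ↔
      (p.1 : ℕ) + 1 < p.2 ∧ ¬((p.1 : ℕ) = 0 ∧ (p.2 : ℕ) = m) := by
  obtain ⟨i, j⟩ := p
  simp only [disjointSides, side, Finset.mem_filter, Finset.mem_univ, true_and,
    Finset.disjoint_insert_left, Finset.disjoint_singleton_left, Finset.mem_insert,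
    Finset.mem_singleton, Fin.ext_iff, coe_finRotate, Fin.lt_def, Fin.val_last]
  have hi := i.isLt
  have hj := j.isLt
  split_ifs <;> simp <;> omega

/-- Disjoint pairs of sides are listed by their larger index; the index `k + 2` belongs to the
closing side, which also meets the side `0`. -/
theorem sum_disjointSides {M : Type*} [AddCommMonoid M] (k : ℕ) (f : ℕ → ℕ → M) :
    ∑ p ∈ disjointSides (k + 3), f p.1 p.2 =
      ∑ j ∈ Finset.range (k + 2), ∑ i ∈ Finset.range (j - 1), f i j +
        ∑ i ∈ Finset.range k, f (i + 1) (k + 2) := by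
  have e : disjointSides (k + 3) = Finset.univ.filter fun p : Fin (k + 3) × Fin (k + 3) =>
      (p.1 : ℕ) + 1 < p.2 ∧ ¬((p.1 : ℕ) = 0 ∧ (p.2 : ℕ) = k + 2) := by
    ext p; simp [mem_disjointSides]
  rw [e, Finset.sum_filter, Fintype.sum_prod_type, Finset.sum_comm,
    Fin.sum_univ_eq_sum_range (fun j : ℕ => ∑ i : Fin (k + 3),
      if (i : ℕ) + 1 < j ∧ ¬((i : ℕ) = 0 ∧ j = k + 2) then f i j else 0), Finset.sum_range_succ]
  congr 1
  · refine Finset.sum_congr rfl fun j hj => ?_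
    have hj := Finset.mem_range.1 hj
    rw [Fin.sum_univ_eq_sum_range
      (fun i : ℕ => if i + 1 < j ∧ ¬(i = 0 ∧ j = k + 2) then f i j else 0), ← Finset.sum_filter]
    refine Finset.sum_congr ?_ fun _ _ => rfl
    ext i
    simp only [Finset.mem_filter, Finset.mem_range]
    omega
  · rw [Fin.sum_univ_eq_sum_range
      (fun i : ℕ => if i + 1 < k + 2 ∧ ¬(i = 0 ∧ k + 2 = k + 2) then f i (k + 2) else 0),
      ← Finset.sum_filter]
    have h : (Finset.range (k + 3)).filter
        (fun i => i + 1 < k + 2 ∧ ¬(i = 0 ∧ k + 2 = k + 2)) = Finset.Ico 1 (k + 1) := by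
      ext i
      simp only [Finset.mem_filter, Finset.mem_range, Finset.mem_Ico, and_true]
      omega
    rw [h, Finset.sum_Ico_eq_sum_range]
    simp only [add_comm 1, Nat.add_sub_cancel]

theorem card_disjointSides {n : ℕ} (hn : 3 ≤ n) : (disjointSides n).card = n * (n - 3) / 2 := by
  obtain ⟨k, rfl⟩ := Nat.exists_eq_add_of_le' hn
  rw [Finset.card_eq_sum_ones, sum_disjointSides k fun _ _ => 1, Finset.sum_range_succ']
  have := Finset.sum_range_id_mul_two (k + 1)
  simp at this ⊢
  symm
  apply Nat.div_eq_of_eq_mul_left two_pos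
  linarith

/-- The cross-ratio of the sides `i` and `j` of the polygon with vertices `p`. -/
noncomputable def polygonRatio {n : ℕ} (p : Fin n → ℝ × ℝ) (i j : Fin n) : ℝ :=
  vecRatio (p i) (p (finRotate n i)) (p j) (p (finRotate n j))

theorem polygonRatio_mem_Ioo {n : ℕ} {p : Fin n → ℝ × ℝ} (hp : PositivePosition p)
    {s : Fin n × Fin n} (hs : s ∈ disjointSides n) : polygonRatio p s.1 s.2 ∈ Ioo (0 : ℝ) 1 := by
  obtain _ | m := n
  · exact s.1.elim0
  obtain ⟨i, j⟩ := s
  obtain ⟨h1, h2⟩ := mem_disjointSides.1 hs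
  simp only at h1 h2
  have hi : (finRotate (m + 1) i : ℕ) = i + 1 := by
    rw [coe_finRotate, if_neg]
    rw [Fin.ext_iff, Fin.val_last]; omega
  have hj := coe_finRotate j
  simp only [polygonRatio]
  generalize finRotate (m + 1) i = i' at *
  generalize finRotate (m + 1) j = j' at *
  have a1 : 0 < det₂ (p i) (p i') := hp _ _ (by rw [Fin.lt_def]; omega)
  have a2 : 0 < det₂ (p i') (p j) := hp _ _ (by rw [Fin.lt_def]; omega)
  have a3 : 0 < det₂ (p i) (p j) := hp _ _ (by rw [Fin.lt_def]; omega)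
  have key : 0 < vecRatio (p i) (p i') (p j) (p j') ∧ 0 < vecRatio (p i') (p j) (p j') (p i) ∧
      det₂ (p i') (p j') ≠ 0 := by
    simp only [Fin.ext_iff, Fin.val_last] at hj
    split_ifs at hj with h
    -- the side `j` is the closing side, and `j'` precedes the other three vertices
    · have b1 : 0 < det₂ (p j') (p i) := hp _ _ (by rw [Fin.lt_def]; omega)
      have b2 : 0 < det₂ (p j') (p i') := hp _ _ (by rw [Fin.lt_def]; omega)
      have b3 : 0 < det₂ (p j') (p j) := hp _ _ (by rw [Fin.lt_def]; omega)
      refine ⟨vecRatio_pos a1 a3 b2 b3, ?_, by rw [det₂_swap (p j')]; linarith⟩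
      rw [vecRatio, det₂_swap (p j') (p i), det₂_swap (p j') (p i'), mul_neg, neg_mul,
        neg_div_neg_eq]
      positivity
    · have b1 : 0 < det₂ (p i) (p j') := hp _ _ (by rw [Fin.lt_def]; omega)
      have b2 : 0 < det₂ (p i') (p j') := hp _ _ (by rw [Fin.lt_def]; omega)
      have b3 : 0 < det₂ (p j) (p j') := hp _ _ (by rw [Fin.lt_def]; omega)
      refine ⟨?_, vecRatio_pos a2 b2 a3 b1, b2.ne'⟩
      rw [vecRatio, det₂_swap (p j) (p j'), det₂_swap (p i') (p j'), mul_neg, mul_neg,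
        neg_div_neg_eq]
      positivity
  have := one_sub_vecRatio (b := p i') (d := p j') a3.ne' key.2.2
  exact ⟨key.1, by linarith [key.2.1]⟩

theorem sum_rogersL_polygonRatio {n : ℕ} (hn : 3 ≤ n) {p : Fin n → ℝ × ℝ}
    (hp : PositivePosition p) :
    ∑ s ∈ disjointSides n, rogersL (polygonRatio p s.1 s.2) = ((n : ℝ) - 3) * π ^ 2 / 6 := by
  obtain ⟨k, rfl⟩ := Nat.exists_eq_add_of_le' hn
  set q : ℕ → ℝ × ℝ := fun i => if h : i < k + 3 then p ⟨i, h⟩ else 0 with hq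
  have hqp : ∀ i : Fin (k + 3), p i = q i := fun i => by simp [hq]
  have key := sum_rogersL_vecRatio q k fun i j hij hj => by
    have := hp ⟨i, by omega⟩ ⟨j, by omega⟩ hij
    rwa [hqp, hqp] at this
  have e := sum_disjointSides k fun i j =>
    rogersL (vecRatio (q i) (q (i + 1)) (q j) (q (if j = k + 2 then 0 else j + 1)))
  simp only [if_true] at e
  have e2 : ∑ j ∈ Finset.range (k + 2), ∑ i ∈ Finset.range (j - 1), rogersL (vecRatio (q i)
        (q (i + 1)) (q j) (q (if j = k + 2 then 0 else j + 1))) =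
      ∑ j ∈ Finset.range (k + 2), ∑ i ∈ Finset.range (j - 1), rogersL (vecRatio (q i)
        (q (i + 1)) (q j) (q (j + 1))) := by
    refine Finset.sum_congr rfl fun j hj => ?_
    rw [if_neg (Finset.mem_range.1 hj).ne]
  rw [e2] at e
  have e3 : ∑ s ∈ disjointSides (k + 3), rogersL (polygonRatio p s.1 s.2) =
      ∑ s ∈ disjointSides (k + 3), rogersL (vecRatio (q s.1) (q (s.1 + 1)) (q s.2)
        (q (if (s.2 : ℕ) = k + 2 then 0 else s.2 + 1))) := by
    refine Finset.sum_congr rfl fun s hs => ?_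
    have h := (mem_disjointSides.1 hs).1
    have h1 : s.1 ≠ Fin.last (k + 2) := by
      rw [ne_eq, Fin.ext_iff, Fin.val_last]; omega
    rw [polygonRatio, hqp, hqp, hqp, hqp, coe_finRotate, coe_finRotate, if_neg h1]
    simp [Fin.ext_iff]
  rw [e3, e]
  refine Eq.trans ?_ (key.trans ?_)
  · rfl
  · push_cast; ring

theorem vecRatio_eq_of_det₂_eq {a b c d a' b' c' d' : ℝ × ℝ} {C x y z w : ℝ}
    (hC : C ≠ 0) (hx : x ≠ 0) (hy : y ≠ 0) (hz : z ≠ 0) (hw : w ≠ 0)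
    (hab : det₂ a' b' = C * (x * y) * det₂ a b) (hdc : det₂ d' c' = C * (w * z) * det₂ d c)
    (hac : det₂ a' c' = C * (x * z) * det₂ a c) (hdb : det₂ d' b' = C * (w * y) * det₂ d b) :
    vecRatio a' b' c' d' = vecRatio a b c d := by
  rw [vecRatio, vecRatio, hab, hdc, hac, hdb,
    ← mul_div_mul_left (det₂ a b * det₂ d c) _ (c := C * C * (x * y * z * w)) (by positivity)]
  congr 1 <;> ring

/-- The cross-ratios do not change under a linear map followed by a rescaling of the vertices. -/
theorem polygonRatio_eq_of_det₂_eq {n : ℕ} {p p' : Fin n → ℝ × ℝ} {C : ℝ} {l : Fin n → ℝ}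
    (hC : C ≠ 0) (hl : ∀ k, l k ≠ 0)
    (h : ∀ i j, det₂ (p' i) (p' j) = C * (l i * l j) * det₂ (p i) (p j)) (i j : Fin n) :
    polygonRatio p' i j = polygonRatio p i j :=
  vecRatio_eq_of_det₂_eq hC (hl _) (hl _) (hl _) (hl _) (h _ _) (h _ _) (h _ _) (h _ _)

/-! ### Polygons in the Poincaré disk -/

/-- Homogeneous coordinates of the point of the real projective line that corresponds to the point
`exp (θ i)` of the unit circle, namely of `-cot (θ / 2)`. -/
noncomputable def circleVec (θ : ℝ) : ℝ × ℝ := (-Real.cos (θ / 2), Real.sin (θ / 2))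

theorem det₂_circleVec (α β : ℝ) :
    det₂ (circleVec α) (circleVec β) = Real.sin (β / 2 - α / 2) := by
  rw [Real.sin_sub]; simp only [det₂, circleVec]; ring

theorem circle_exp_sub (α β : ℝ) :
    (Circle.exp α : ℂ) - Circle.exp β =
      -2 * Complex.I * (Complex.exp (α / 2 * Complex.I) * Complex.exp (β / 2 * Complex.I)) *
        (det₂ (circleVec α) (circleVec β) : ℝ) := by
  rw [det₂_circleVec, Circle.coe_exp, Circle.coe_exp, Complex.ofReal_sin, Complex.sin]
  push_cast
  have h1 : Complex.exp (α * Complex.I) = Complex.exp (α / 2 * Complex.I) *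
      Complex.exp (β / 2 * Complex.I) * Complex.exp (-(β / 2 - α / 2) * Complex.I) := by
    rw [← Complex.exp_add, ← Complex.exp_add]; congr 1; ring
  have h2 : Complex.exp (β * Complex.I) = Complex.exp (α / 2 * Complex.I) *
      Complex.exp (β / 2 * Complex.I) * Complex.exp ((β / 2 - α / 2) * Complex.I) := by
    rw [← Complex.exp_add, ← Complex.exp_add]; congr 1; ring
  rw [h1, h2]
  linear_combination (Complex.exp (α / 2 * Complex.I) *
      Complex.exp (β / 2 * Complex.I) * (Complex.exp (-(β / 2 - α / 2) * Complex.I)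
      - Complex.exp ((β / 2 - α / 2) * Complex.I))) * Complex.I_mul_I

theorem crossRatio_circle_exp (α β γ δ : ℝ) :
    crossRatio (Circle.exp α) (Circle.exp β) (Circle.exp γ) (Circle.exp δ) =
      (vecRatio (circleVec α) (circleVec β) (circleVec γ) (circleVec δ) : ℝ) := by
  simp only [crossRatio, vecRatio, circle_exp_sub]
  have hne : (-2 * Complex.I) * (-2 * Complex.I) * (Complex.exp (α / 2 * Complex.I) *
      Complex.exp (β / 2 * Complex.I) * Complex.exp (γ / 2 * Complex.I) *
      Complex.exp (δ / 2 * Complex.I)) ≠ 0 := by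
    simp [Complex.exp_ne_zero]
  push_cast
  have := mul_div_mul_left
    ((det₂ (circleVec α) (circleVec β) : ℂ) * det₂ (circleVec δ) (circleVec γ))
    ((det₂ (circleVec α) (circleVec γ) : ℂ) * det₂ (circleVec δ) (circleVec β)) hne
  rw [← this]
  congr 1 <;> ring

theorem sideCrossRatio_circle_exp {n : ℕ} {x : Fin n → Circle} {θ : Fin n → ℝ}
    (hx : ∀ i, x i = Circle.exp (θ i)) (i j : Fin n) :
    sideCrossRatio x i j = (polygonRatio (fun k => circleVec (θ k)) i j : ℝ) := by
  rw [sideCrossRatio, hx, hx, hx, hx, crossRatio_circle_exp, polygonRatio]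

theorem positivePosition_circleVec {n : ℕ} {θ : Fin n → ℝ} (hmono : StrictMono θ)
    (hturn : ∀ i j, θ i < θ j + 2 * π) : PositivePosition fun k => circleVec (θ k) := by
  intro i j hij
  rw [det₂_circleVec]
  exact Real.sin_pos_of_pos_of_lt_pi (by linarith [hmono hij]) (by linarith [hturn j i])

/-! ### Normalized polygons in the upper half-plane -/

/-- The values at `u` of the homogeneous coordinates of the vertices of the general normalized
polygon. -/
noncomputable def normalizedVec {n : ℕ} (u : Fin (n - 3) → ℝ) (k : Fin n) : ℝ × ℝ :=
  (MvPolynomial.aeval u (normalizedVertex n k).1, MvPolynomial.aeval u (normalizedVertex n k).2)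

theorem normalizedVec_eq {n : ℕ} (u : Fin (n - 3) → ℝ) (k : Fin n) :
    normalizedVec u k = if (k : ℕ) = 0 then (0, 1)
      else if h : (k : ℕ) - 1 < n - 3 then (u ⟨(k : ℕ) - 1, h⟩, 1)
      else if (k : ℕ) = n - 2 then (1, 1) else (1, 0) := by
  unfold normalizedVec normalizedVertex
  split_ifs <;> simp

theorem normalizedVec_succ {n : ℕ} (u : Fin (n - 3) → ℝ) (t : Fin (n - 3)) :
    normalizedVec u ⟨t + 1, by omega⟩ = (u t, 1) := by
  simp [normalizedVec_eq]

theorem normalizedVec_zero {n : ℕ} (hn : 3 ≤ n) (u : Fin (n - 3) → ℝ) :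
    normalizedVec u ⟨0, by omega⟩ = (0, 1) := by
  simp [normalizedVec_eq]

theorem normalizedVec_penultimate {n : ℕ} (hn : 3 ≤ n) (u : Fin (n - 3) → ℝ) :
    normalizedVec u ⟨n - 2, by omega⟩ = (1, 1) := by
  rw [normalizedVec_eq, if_neg (by simp; omega), dif_neg (by simp; omega), if_pos rfl]

theorem normalizedVec_last {n : ℕ} (hn : 3 ≤ n) (u : Fin (n - 3) → ℝ) :
    normalizedVec u ⟨n - 1, by omega⟩ = (1, 0) := by
  rw [normalizedVec_eq, if_neg (by simp; omega), dif_neg (by simp; omega),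
    if_neg (by simp; omega)]

theorem aeval_vertexDet {n : ℕ} (u : Fin (n - 3) → ℝ) (k l : Fin n) :
    MvPolynomial.aeval u (vertexDet n k l) =
      -det₂ (normalizedVec u k) (normalizedVec u l) := by
  simp [vertexDet, det₂, normalizedVec]

theorem sideRatio_eq_polygonRatio {n : ℕ} (u : Fin (n - 3) → ℝ) (i j : Fin n) :
    sideRatio n i j u = polygonRatio (normalizedVec u) i j := by
  simp only [sideRatio, sideNum, sideDen, map_mul, aeval_vertexDet, neg_mul_neg, polygonRatio,
    vecRatio]

/-- The vertices of a polygon with at least three vertices, sorted by their role in the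
normalization. -/
theorem vertex_cases {n : ℕ} (hn : 3 ≤ n) (k : Fin n) :
    k = ⟨0, by omega⟩ ∨ (∃ t : Fin (n - 3), k = ⟨t + 1, by omega⟩) ∨ k = ⟨n - 2, by omega⟩ ∨
      k = ⟨n - 1, by omega⟩ := by
  obtain ⟨k, hk⟩ := k
  simp only [Fin.mk.injEq]
  by_cases h : 1 ≤ k ∧ k < n - 2
  · exact Or.inr (Or.inl ⟨⟨k - 1, by omega⟩, by simp; omega⟩)
  · omega

theorem positivePosition_normalizedVec_iff {n : ℕ} (hn : 3 ≤ n) (u : Fin (n - 3) → ℝ) :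
    PositivePosition (normalizedVec u) ↔ u ∈ polygonParameters n := by
  constructor
  · intro h
    refine ⟨fun s t hst => ?_, fun t => ⟨?_, ?_⟩⟩
    · have := h ⟨s + 1, by omega⟩ ⟨t + 1, by omega⟩ (by simpa using hst)
      rw [normalizedVec_succ, normalizedVec_succ] at this
      simpa [det₂] using this
    · have := h ⟨0, by omega⟩ ⟨t + 1, by omega⟩ (by simp)
      rw [normalizedVec_zero hn, normalizedVec_succ] at this
      simpa [det₂] using this
    · have := h ⟨t + 1, by omega⟩ ⟨n - 2, by omega⟩ (by simp; omega)
      rw [normalizedVec_penultimate hn, normalizedVec_succ] at this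
      simpa [det₂] using this
  · rintro ⟨hm, h01⟩ i j hij
    rcases vertex_cases hn i with rfl | ⟨s, rfl⟩ | rfl | rfl <;>
      rcases vertex_cases hn j with rfl | ⟨t, rfl⟩ | rfl | rfl <;>
      simp only [normalizedVec_zero hn, normalizedVec_succ, normalizedVec_penultimate hn,
        normalizedVec_last hn, det₂] <;>
      simp only [Fin.lt_def] at hij <;>
      first
        | (exfalso; omega)
        | (norm_num; done)
        | (have := h01 s; have := hm (show s < t by rw [Fin.lt_def]; omega); linarith)
        | (have := h01 s; linarith)
        | (have := h01 t; linarith)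

/-- Every polygon in positive position has the cross-ratios of a normalized one: the linear map
that sends the first, the penultimate and the last vertex to `0`, `1` and `∞` turns the other
vertices into the parameters. -/
theorem exists_normalizedVec {n : ℕ} (hn : 3 ≤ n) {p : Fin n → ℝ × ℝ} (hp : PositivePosition p) :
    ∃ u ∈ polygonParameters n, ∀ i j, polygonRatio p i j = sideRatio n i j u := by
  set o : Fin n := ⟨0, by omega⟩ with ho
  set e : Fin n := ⟨n - 2, by omega⟩ with he
  set w : Fin n := ⟨n - 1, by omega⟩ with hw
  have hoe : 0 < det₂ (p o) (p e) := hp _ _ (by simp [ho, he]; omega)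
  have how : 0 < det₂ (p o) (p w) := hp _ _ (by simp [ho, hw]; omega)
  have hew : 0 < det₂ (p e) (p w) := hp _ _ (by simp [he, hw]; omega)
  have hkw : ∀ k, k ≠ w → 0 < det₂ (p k) (p w) := fun k hk => hp _ _ (by
    rw [ne_eq, Fin.ext_iff] at hk
    rw [Fin.lt_def]
    simp only [hw] at hk ⊢
    omega)
  set u : Fin (n - 3) → ℝ := fun t =>
    det₂ (p o) (p ⟨t + 1, by omega⟩) * det₂ (p e) (p w) /
      (det₂ (p o) (p e) * det₂ (p ⟨t + 1, by omega⟩) (p w)) with hu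
  -- these factors make the last coordinate `1`, except at the vertex `∞`
  set l : Fin n → ℝ := fun k => if k = w then (det₂ (p e) (p w) * det₂ (p o) (p w))⁻¹
    else (det₂ (p o) (p e) * det₂ (p k) (p w))⁻¹ with hl
  have hlpos : ∀ k, 0 < l k := by
    intro k
    by_cases h : k = w
    · simp only [hl, if_pos h]; positivity
    · have := hkw k h
      simp only [hl, if_neg h]; positivity
  have hvec : ∀ k, normalizedVec u k = (l k * (det₂ (p e) (p w) * det₂ (p o) (p k)),
      l k * (det₂ (p o) (p e) * det₂ (p k) (p w))) := by
    intro k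
    by_cases h : k = w
    · have hs : det₂ (p w) (p w) = 0 := by simp [det₂]
      simp only [hl, h, if_true]
      rw [normalizedVec_last hn, hs, inv_mul_cancel₀ (by positivity)]
      simp
    · have h1 := hkw k h
      have h2 : l k * (det₂ (p o) (p e) * det₂ (p k) (p w)) = 1 := by
        simp only [hl, if_neg h]
        exact inv_mul_cancel₀ (by positivity)
      rw [h2]
      simp only [hl, if_neg h]
      rcases vertex_cases hn k with rfl | ⟨s, rfl⟩ | rfl | rfl
      · have hs : det₂ (p o) (p o) = 0 := by simp [det₂]
        rw [normalizedVec_zero hn, hs]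
        simp
      · rw [normalizedVec_succ]
        simp only [hu, Prod.mk.injEq, and_true]
        field_simp
      · rw [normalizedVec_penultimate hn]
        simp only [Prod.mk.injEq, and_true]
        change 0 < det₂ (p e) (p w) at h1
        change _ = (det₂ (p o) (p e) * det₂ (p e) (p w))⁻¹ * (det₂ (p e) (p w) * det₂ (p o) (p e))
        field_simp
      · exact absurd rfl h
  have hC : 0 < det₂ (p e) (p w) * det₂ (p o) (p e) * det₂ (p o) (p w) := by positivity
  have hdet : ∀ i j, det₂ (normalizedVec u i) (normalizedVec u j) =
      det₂ (p e) (p w) * det₂ (p o) (p e) * det₂ (p o) (p w) * (l i * l j) *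
        det₂ (p i) (p j) := by
    intro i j
    rw [hvec, hvec]
    have := det₂_pluecker (p o) (p i) (p j) (p w)
    generalize det₂ (p e) (p w) = α at *
    generalize det₂ (p o) (p e) = β at *
    rw [det₂]
    linear_combination (-(l i * l j * α * β)) * this
  refine ⟨u, (positivePosition_normalizedVec_iff hn u).1 fun i j hij => ?_, fun i j => ?_⟩
  · have := hp i j hij
    have := hlpos i
    have := hlpos j
    rw [hdet]
    positivity
  · rw [sideRatio_eq_polygonRatio]
    exact (polygonRatio_eq_of_det₂_eq hC.ne' (fun k => (hlpos k).ne') hdet i j).symm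

theorem normalizedVec_succ_succ_snd {n : ℕ} (u : Fin (n - 3) → ℝ) (t : Fin (n - 3)) :
    (normalizedVec u ⟨t + 2, by omega⟩).2 = 1 := by
  rw [normalizedVec_eq]
  split_ifs <;> simp at * ; omega

/-- The cross-ratio with the closing side determines the quotient of consecutive vertices. -/
theorem sideRatio_last {n : ℕ} (hn : 3 ≤ n) (u : Fin (n - 3) → ℝ) (t : Fin (n - 3)) :
    sideRatio n ⟨t + 1, by omega⟩ ⟨n - 1, by omega⟩ u =
      ((normalizedVec u ⟨t + 2, by omega⟩).1 - u t) / (normalizedVec u ⟨t + 2, by omega⟩).1 := by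
  have r1 : finRotate n ⟨n - 1, by omega⟩ = ⟨0, by omega⟩ := by
    obtain ⟨k, rfl⟩ := Nat.exists_eq_add_of_le' hn
    exact finRotate_last
  have r2 : finRotate n ⟨t + 1, by omega⟩ = ⟨t + 2, by omega⟩ := by
    have ht := t.2
    obtain ⟨k, rfl⟩ := Nat.exists_eq_add_of_le' hn
    exact finRotate_of_lt (by omega)
  rw [sideRatio_eq_polygonRatio, polygonRatio, r1, r2, normalizedVec_succ, normalizedVec_zero hn,
    normalizedVec_last hn, vecRatio]
  simp [det₂, normalizedVec_succ_succ_snd]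

theorem polygonParameters_ext {n : ℕ} (hn : 3 ≤ n) {u v : Fin (n - 3) → ℝ}
    (hu : u ∈ polygonParameters n)
    (h : ∀ s ∈ disjointSides n, sideRatio n s.1 s.2 u = sideRatio n s.1 s.2 v) : u = v := by
  -- downward induction on the index: the last finite vertex is `1`
  have key : ∀ d : ℕ, ∀ t : Fin (n - 3), (t : ℕ) + d + 1 = n - 3 → u t = v t := by
    intro d
    induction d with
    | zero =>
      intro t ht
      have e := h (⟨t + 1, by omega⟩, ⟨n - 1, by omega⟩) (by
        obtain ⟨k, rfl⟩ := Nat.exists_eq_add_of_le' hn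
        rw [mem_disjointSides]; simp; omega)
      simp only [sideRatio_last hn] at e
      have ht' : (⟨t + 2, by omega⟩ : Fin n) = ⟨n - 2, by omega⟩ := by
        rw [Fin.mk.injEq]; omega
      simp only [ht', normalizedVec_penultimate hn] at e
      linarith
    | succ d ih =>
      intro t ht
      have e := h (⟨t + 1, by omega⟩, ⟨n - 1, by omega⟩) (by
        obtain ⟨k, rfl⟩ := Nat.exists_eq_add_of_le' hn
        rw [mem_disjointSides]; simp; omega)
      have hs := ih ⟨t + 1, by omega⟩ (by simp; omega)
      have h0 := (hu.2 ⟨t + 1, by omega⟩).1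
      simp only [sideRatio_last hn] at e
      have n1 := normalizedVec_succ u ⟨t + 1, by omega⟩
      have n2 := normalizedVec_succ v ⟨t + 1, by omega⟩
      simp only [add_assoc, Nat.reduceAdd] at n1 n2
      rw [n1, n2, ← hs, div_left_inj' h0.ne'] at e
      linarith
  funext t
  exact key (n - 3 - 1 - t) t (by omega)

/-- Every normalized polygon comes from a polygon in the disk, by `z = -cot (θ / 2)`. -/
theorem exists_isIdealPolygon {n : ℕ} (hn : 3 ≤ n) {u : Fin (n - 3) → ℝ}
    (hu : u ∈ polygonParameters n) : ∃ x : Fin n → Circle, IsIdealPolygon x ∧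
      ∀ i j, sideCrossRatio x i j = (sideRatio n i j u : ℂ) := by
  set w : Fin n := ⟨n - 1, by omega⟩ with hw
  set z : Fin n → ℝ := fun k => (normalizedVec u k).1 with hz
  have hvec : ∀ k, k ≠ w → normalizedVec u k = (z k, 1) := by
    intro k hk
    rcases vertex_cases hn k with rfl | ⟨s, rfl⟩ | rfl | rfl
    · simp [hz, normalizedVec_zero hn]
    · simp [hz, normalizedVec_succ]
    · simp [hz, normalizedVec_penultimate hn]
    · exact absurd rfl hk
  have hpos := (positivePosition_normalizedVec_iff hn u).2 hu
  set θ : Fin n → ℝ := fun k => if k = w then 2 * π else 2 * Real.arctan (z k) + π with hθ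
  have h0 : ∀ k, 0 < θ k := by
    intro k
    have := Real.neg_pi_div_two_lt_arctan (z k)
    have := Real.pi_pos
    simp only [hθ]
    split_ifs <;> linarith
  have h2 : ∀ k, θ k ≤ 2 * π := by
    intro k
    have := Real.arctan_lt_pi_div_two (z k)
    simp only [hθ]
    split_ifs <;> linarith
  have hmono : StrictMono θ := by
    intro i j hij
    have hi : i ≠ w := by
      rintro rfl
      simp only [hw, Fin.lt_def] at hij
      omega
    by_cases hj : j = w
    · have := Real.arctan_lt_pi_div_two (z i)
      simp only [hθ, if_neg hi, if_pos hj]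
      linarith
    · have h := hpos i j hij
      rw [hvec i hi, hvec j hj] at h
      simp only [det₂, mul_one, sub_pos] at h
      have := Real.arctan_strictMono h
      simp only [hθ, if_neg hi, if_neg hj]
      linarith
  set l : Fin n → ℝ := fun k => if k = w then 1 else Real.cos (Real.arctan (z k)) with hl
  have hl0 : ∀ k, l k ≠ 0 := by
    intro k
    have := Real.cos_arctan_pos (z k)
    simp only [hl]
    split_ifs
    · exact one_ne_zero
    · exact this.ne'
  have hcirc : ∀ k,
      circleVec (θ k) = (l k * (normalizedVec u k).1, l k * (normalizedVec u k).2) := by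
    intro k
    by_cases hk : k = w
    · simp only [hθ, hl, hk, if_true, circleVec]
      simp [hw, normalizedVec_last hn]
    · have e : (2 * Real.arctan (z k) + π) / 2 = Real.arctan (z k) + π / 2 := by ring
      have t := Real.tan_mul_cos (Real.cos_arctan_pos (z k)).ne'
      rw [Real.tan_arctan] at t
      rw [hvec k hk]
      simp only [hθ, hl, if_neg hk, circleVec, e, Real.cos_add_pi_div_two,
        Real.sin_add_pi_div_two, neg_neg, mul_one]
      rw [← t, mul_comm]
  refine ⟨fun k => Circle.exp (θ k), ⟨θ, hmono, fun i j => ?_, fun _ => rfl⟩, fun i j => ?_⟩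
  · linarith [h2 i, h0 j]
  · rw [sideCrossRatio_circle_exp (fun _ => rfl), sideRatio_eq_polygonRatio,
      polygonRatio_eq_of_det₂_eq (C := 1) one_ne_zero hl0 fun i j => ?_]
    simp only [hcirc, det₂]
    ring

/-! ### The identity for ideal polygons -/

theorem mainTheorem3 :
    -- the identity for every ideal `n`-gon; the cross-ratios are real numbers in `(0, 1)`
    (∀ (n : ℕ), 3 ≤ n → ∀ x : Fin n → Circle, IsIdealPolygon x →
      (∀ p ∈ disjointSides n, (sideCrossRatio x p.1 p.2).im = 0 ∧
        0 < (sideCrossRatio x p.1 p.2).re ∧ (sideCrossRatio x p.1 p.2).re < 1) ∧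
      ∑ p ∈ disjointSides n, rogersL (sideCrossRatio x p.1 p.2).re
        = ((n : ℝ) - 3) * Real.pi ^ 2 / 6) ∧
    -- it is an identity between `n (n - 3) / 2` values of `ℒ` at rational functions of `n - 3`
    -- variables, and these variables parametrize the ideal `n`-gons
    (∀ (n : ℕ), 3 ≤ n →
      (disjointSides n).card = n * (n - 3) / 2 ∧
      (∀ u ∈ polygonParameters n,
        (∀ p ∈ disjointSides n, MvPolynomial.aeval u (sideDen n p.1 p.2) ≠ 0 ∧
          0 < sideRatio n p.1 p.2 u ∧ sideRatio n p.1 p.2 u < 1) ∧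
        ∑ p ∈ disjointSides n, rogersL (sideRatio n p.1 p.2 u)
          = ((n : ℝ) - 3) * Real.pi ^ 2 / 6) ∧
      (∀ x : Fin n → Circle, IsIdealPolygon x → ∃! u : Fin (n - 3) → ℝ,
        u ∈ polygonParameters n ∧
        ∀ p ∈ disjointSides n, sideCrossRatio x p.1 p.2 = (sideRatio n p.1 p.2 u : ℂ)) ∧
      (∀ u ∈ polygonParameters n, ∃ x : Fin n → Circle, IsIdealPolygon x ∧
        ∀ p ∈ disjointSides n, sideCrossRatio x p.1 p.2 = (sideRatio n p.1 p.2 u : ℂ))) ∧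
    -- the case `n = 4` is Euler's reflection identity, in both of its forms
    (disjointSides 4 = {(0, 2), (1, 3)} ∧
      (∀ b : ℝ, 0 < b → b < 1 →
        ![b] ∈ polygonParameters 4 ∧
        sideRatio 4 0 2 ![b] = b ∧ sideRatio 4 1 3 ![b] = 1 - b) ∧
      rogersL 1 = Real.pi ^ 2 / 6 ∧
      (∀ b : ℝ, 0 ≤ b → b ≤ 1 → rogersL b + rogersL (1 - b) = Real.pi ^ 2 / 6) ∧
      (∀ a : ℝ, a < 0 → rogersL a + rogersL a⁻¹ = -(Real.pi ^ 2 / 6))) ∧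
    -- the case `n = 5` is Abel's five-term identity
    (disjointSides 5 = {(0, 2), (0, 3), (1, 3), (1, 4), (2, 4)} ∧
      (∀ u v : ℝ, 0 < u → u < v → v < 1 →
        ![u, v] ∈ polygonParameters 5 ∧
        sideRatio 5 0 2 ![u, v] = u * (1 - v) / (v * (1 - u)) ∧
        sideRatio 5 0 3 ![u, v] = u ∧
        sideRatio 5 1 3 ![u, v] = (v - u) / (1 - u) ∧
        sideRatio 5 1 4 ![u, v] = (v - u) / v ∧
        sideRatio 5 2 4 ![u, v] = 1 - v) ∧
      (∀ x y : ℝ, 0 < x → x < 1 → 0 < y → y < 1 →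
        rogersL x + rogersL y = rogersL (x * y) + rogersL (x * (1 - y) / (1 - x * y)) +
          rogersL (y * (1 - x) / (1 - x * y)))) := by
  refine ⟨fun n hn x ⟨θ, hmono, hturn, hx⟩ => ?_, fun n hn => ⟨card_disjointSides hn, ?_, ?_, ?_⟩,
    ⟨by decide, ?_, rogersL_one, fun b h0 h1 => rogersL_add_rogersL_one_sub h0 h1,
      fun a ha => rogersL_add_rogersL_inv ha⟩,
    ⟨by decide, ?_, fun x y hx0 hx1 hy0 hy1 => rogersL_five_term hx0 hx1 hy0 hy1⟩⟩
  · have hp := positivePosition_circleVec hmono hturn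
    simp only [sideCrossRatio_circle_exp hx, Complex.ofReal_re, Complex.ofReal_im]
    exact ⟨fun s hs => ⟨trivial, polygonRatio_mem_Ioo hp hs⟩, sum_rogersL_polygonRatio hn hp⟩
  · intro u hu
    have hp := (positivePosition_normalizedVec_iff hn u).2 hu
    have hI : ∀ s ∈ disjointSides n, sideRatio n s.1 s.2 u ∈ Ioo (0 : ℝ) 1 := fun s hs => by
      rw [sideRatio_eq_polygonRatio]
      exact polygonRatio_mem_Ioo hp hs
    refine ⟨fun s hs => ⟨fun h => ?_, hI s hs⟩, ?_⟩
    -- a vanishing denominator would make the quotient `0`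
    · have := (hI s hs).1
      rw [sideRatio, h, div_zero] at this
      exact lt_irrefl _ this
    · simp only [sideRatio_eq_polygonRatio]
      exact sum_rogersL_polygonRatio hn hp
  · rintro x ⟨θ, hmono, hturn, hx⟩
    obtain ⟨u, hu, h⟩ := exists_normalizedVec hn (positivePosition_circleVec hmono hturn)
    simp only [sideCrossRatio_circle_exp hx, h, Complex.ofReal_inj]
    exact ⟨u, ⟨hu, fun _ _ => rfl⟩, fun v hv => (polygonParameters_ext hn hu hv.2).symm⟩
  · intro u hu
    obtain ⟨x, hx, h⟩ := exists_isIdealPolygon hn hu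
    exact ⟨x, hx, fun s _ => h s.1 s.2⟩
  · intro b h0 h1
    have v0 : normalizedVec (n := 4) ![b] 0 = (0, 1) := by simp [normalizedVec_eq]
    have v1 : normalizedVec (n := 4) ![b] 1 = (b, 1) := by simp [normalizedVec_eq]
    have v2 : normalizedVec (n := 4) ![b] 2 = (1, 1) := by simp [normalizedVec_eq]
    have v3 : normalizedVec (n := 4) ![b] 3 = (1, 0) := by simp [normalizedVec_eq]
    have r0 : finRotate 4 0 = 1 := by decide
    have r1 : finRotate 4 1 = 2 := by decide
    have r2 : finRotate 4 2 = 3 := by decide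
    have r3 : finRotate 4 3 = 0 := by decide
    refine ⟨⟨fun i j hij => absurd hij (by rw [Fin.lt_def]; omega), fun k => ?_⟩, ?_, ?_⟩
    · fin_cases k; exact ⟨h0, h1⟩
    all_goals
      rw [sideRatio_eq_polygonRatio]
      simp only [polygonRatio, r0, r1, r2, r3, v0, v1, v2, v3, vecRatio, det₂]
      norm_num
  · intro u v h0 huv h1
    have v0 : normalizedVec (n := 5) ![u, v] 0 = (0, 1) := by simp [normalizedVec_eq]
    have v1 : normalizedVec (n := 5) ![u, v] 1 = (u, 1) := by simp [normalizedVec_eq]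
    have v2 : normalizedVec (n := 5) ![u, v] 2 = (v, 1) := by simp [normalizedVec_eq]
    have v3 : normalizedVec (n := 5) ![u, v] 3 = (1, 1) := by simp [normalizedVec_eq]
    have v4 : normalizedVec (n := 5) ![u, v] 4 = (1, 0) := by simp [normalizedVec_eq]
    have r0 : finRotate 5 0 = 1 := by decide
    have r1 : finRotate 5 1 = 2 := by decide
    have r2 : finRotate 5 2 = 3 := by decide
    have r3 : finRotate 5 3 = 4 := by decide
    have r4 : finRotate 5 4 = 0 := by decide
    refine ⟨⟨?_, fun k => ?_⟩, ?_⟩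
    · intro i j hij
      fin_cases i <;> fin_cases j <;> simp at hij ⊢
      exact huv
    · fin_cases k
      · exact ⟨h0, huv.trans h1⟩
      · exact ⟨h0.trans huv, h1⟩
    simp only [sideRatio_eq_polygonRatio, polygonRatio, r0, r1, r2, r3, r4, v0, v1, v2, v3, v4,
      vecRatio, det₂]
    refine ⟨?_, by norm_num, ?_, by norm_num, by norm_num⟩
    · norm_num
      rw [← neg_sub 1 v, ← neg_sub 1 u, mul_neg, mul_neg, neg_div_neg_eq]
    · norm_num
      rw [← neg_sub v u, ← neg_sub 1 u, neg_div_neg_eq]
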